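/- For every real number $\alpha$, $$\Bigl(\frac{\pi^2}{9}\Bigr)^{\alpha}=1+\sum_{n=1}^{\infty}(-1)^n\sum_{j=1}^{n}(-1)^j\,\frac{\langle\alpha\rangle_j}{j!}\sum_{\ell=1}^{j}(-1)^{\ell}\,(2\ell)!\binom{j}{\ell}\frac{Q(2\ell,2n)}{(2\ell+2n)!},$$ where the series over $n$ converges absolutely. Here $\langle\alpha\rangle_j=\prod_{i=0}^{j-1}(\alpha-i)$ is the falling factorial and, for integers $k\ge 1$ and $m\ge 2$, $$Q(k,m)=\sum_{\ell=0}^{m}\binom{k+\ell-1}{k-1}\,s(k+m-1,k+\ell-1)\Bigl(\frac{k+m-2}{2}\Bigr)^{\ell},$$ where $s(n,k)$ are the (signed) Stirling numbers of the first kind, determined by $\dfrac{[\ln(1+x)]^k}{k!}=\sum_{n=k}^{\infty}s(n,k)\dfrac{x^n}{n!}$ for $|x|<1$. -/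

import Mathlib

noncomputable section

/-- The signed Stirling number of the first kind `s(n, k)`: the coefficient of `x ^ k` in the
falling factorial `x (x - 1) ⋯ (x - n + 1)`, and `n! / k!` times the coefficient of `x ^ n` in
`(log (1 + x)) ^ k`. Mathlib's `Nat.stirlingFirst` is the unsigned number `|s(n, k)|`. -/
def signedStirlingFirst (n k : ℕ) : ℤ :=
  (-1) ^ (n - k) * (Nat.stirlingFirst n k : ℤ)

/-- The falling factorial `⟨β⟩_n = β (β - 1) ⋯ (β - n + 1)` of a real number `β`. -/
def fallingFactorial (β : ℝ) (n : ℕ) : ℝ :=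
  ∏ k ∈ Finset.range n, (β - (k : ℝ))

/-- `Q(k, m) = ∑_{ℓ=0}^{m} C(k+ℓ-1, k-1) s(k+m-1, k+ℓ-1) ((k+m-2)/2)^ℓ`,
meant for `k ≥ 1` and `m ≥ 2` (only then are the natural-number subtractions the true ones). -/
def stirlingQ (k m : ℕ) : ℝ :=
  ∑ ℓ ∈ Finset.range (m + 1),
    (Nat.choose (k + ℓ - 1) (k - 1) : ℝ) *
      (signedStirlingFirst (k + m - 1) (k + ℓ - 1) : ℝ) *
      (((k : ℝ) + (m : ℝ) - 2) / 2) ^ ℓ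

end

/-! At x = 1/2 the function (arcsin x / x)² equals π²/9. Write it as 1 + g, with g a power series in
(2x)² that has nonnegative coefficients and no constant term. These coefficients sum to π²/9 - 1 <
1, so the binomial series for (1 + g)^α converges absolutely and may be regrouped by powers of the
variable (`hasSum_one_add_rpow`). Expanding g^j = ((1 + g) - 1)^j reduces its coefficients to those
of arcsin^(2ℓ). The differential equation of arcsin² shows that these are central factorial numbers
(`coeff_arcsinSq_pow`). Q(2ℓ, 2n) is the same number, read off a falling factorial recentred at the
midpoint of its roots (`stirlingQ_eq_coeff_centralFactorial`). -/

/-- The coefficients of `arcsin² x = ∑ aₘ x ^ (2 m)`. -/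
noncomputable def arcsinSqCoeff : ℕ → ℝ
  | 0 => 0
  | 1 => 1
  | m + 2 => 4 * (m + 1 : ℝ) ^ 2 / ((2 * m + 4) * (2 * m + 3)) * arcsinSqCoeff (m + 1)

theorem arcsinSqCoeff_rec (m : ℕ) :
    (2 * m + 2 : ℝ) * (2 * m + 1) * arcsinSqCoeff (m + 1) =
      4 * (m : ℝ) ^ 2 * arcsinSqCoeff m + if m = 0 then 2 else 0 := by
  cases m with
  | zero => simp [arcsinSqCoeff]
  | succ m =>
    rw [arcsinSqCoeff]
    push_cast
    have h : (2 * m + 4 : ℝ) * (2 * m + 3) ≠ 0 := by positivity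
    field_simp
    ring

theorem arcsinSqCoeff_nonneg : ∀ m, 0 ≤ arcsinSqCoeff m
  | 0 => le_rfl
  | 1 => zero_le_one
  | m + 2 => by
    rw [arcsinSqCoeff]
    exact mul_nonneg (by positivity) (arcsinSqCoeff_nonneg (m + 1))

theorem arcsinSqCoeff_le_one : ∀ m, arcsinSqCoeff m ≤ 1
  | 0 => zero_le_one
  | 1 => le_rfl
  | m + 2 => by
    rw [arcsinSqCoeff]
    refine mul_le_one₀ ?_ (arcsinSqCoeff_nonneg _) (arcsinSqCoeff_le_one (m + 1))
    rw [div_le_one (by positivity)]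
    have : (0 : ℝ) ≤ m := m.cast_nonneg
    nlinarith

/-! ### Formal powers of arcsin² and their differential equation -/

namespace PowerSeries

/-- The operator `(1 - x²) d²/dx² - x d/dx`, written in the variable `t = x²`. -/
noncomputable def arcsinOp (z : PowerSeries ℝ) : PowerSeries ℝ :=
  4 * X * (1 - X) * d⁄dX ℝ (d⁄dX ℝ z) + (2 - 4 * X) * d⁄dX ℝ z

theorem coeff_arcsinOp (z : PowerSeries ℝ) (m : ℕ) :
    coeff m (arcsinOp z) =
      (2 * m + 2) * (2 * m + 1) * coeff (m + 1) z - 4 * (m : ℝ) ^ 2 * coeff m z := by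
  have e : arcsinOp z = C 4 * (X * d⁄dX ℝ (d⁄dX ℝ z)) - C 4 * (X * (X * d⁄dX ℝ (d⁄dX ℝ z)))
      + C 2 * d⁄dX ℝ z - C 4 * (X * d⁄dX ℝ z) := by
    simp only [arcsinOp, map_ofNat]; ring
  rw [e]
  rcases m with _ | _ | m
  · simp only [map_add, map_sub, coeff_C_mul, coeff_zero_X_mul, coeff_derivative]
    push_cast; ring
  · simp only [map_add, map_sub, coeff_C_mul, coeff_succ_X_mul, coeff_zero_X_mul, coeff_derivative]
    push_cast; ring
  · simp only [map_add, map_sub, coeff_C_mul, coeff_succ_X_mul, coeff_derivative]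
    push_cast; ring

/-- `arcsin² x` as a power series in `t = x²`. -/
noncomputable def arcsinSq : PowerSeries ℝ := mk arcsinSqCoeff

theorem arcsinOp_arcsinSq : arcsinOp arcsinSq = C 2 := by
  ext m
  rw [coeff_arcsinOp, arcsinSq, coeff_mk, coeff_mk, arcsinSqCoeff_rec, coeff_C]
  ring

/-- A first integral of the equation: multiplying `arcsinOp_arcsinSq` by half the derivative of
`arcsinSq` shows that both sides have the same derivative, and both constant terms vanish. -/
theorem X_mul_deriv_arcsinSq_sq :
    X * (1 - X) * (d⁄dX ℝ arcsinSq) ^ 2 = arcsinSq := by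
  apply derivative.ext
  · have h := arcsinOp_arcsinSq
    rw [arcsinOp, map_ofNat] at h
    simp only [Derivation.leibniz, Derivation.leibniz_pow, map_sub, derivative_X, derivative_one,
      smul_eq_mul, nsmul_eq_mul]
    have h2 : (C (2 : ℝ)) * C (1 / 2) = 1 := by rw [← map_mul]; norm_num
    rw [map_ofNat] at h2
    push_cast
    linear_combination (d⁄dX ℝ arcsinSq) * C (1 / 2) * h + (d⁄dX ℝ arcsinSq
      - 2 * (d⁄dX ℝ arcsinSq) * X * (1 - X) * d⁄dX ℝ (d⁄dX ℝ arcsinSq)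
      - (1 - 2 * X) * (d⁄dX ℝ arcsinSq) ^ 2) * h2
  · simp [arcsinSq, arcsinSqCoeff]

theorem arcsinOp_arcsinSq_pow (k : ℕ) :
    arcsinOp (arcsinSq ^ (k + 1)) = C ((2 * k + 2) * (2 * k + 1) : ℝ) * arcsinSq ^ k := by
  have h := arcsinOp_arcsinSq
  have h1 := X_mul_deriv_arcsinSq_sq
  cases k with
  | zero => simpa using h
  | succ k =>
    rw [arcsinOp, map_ofNat] at h
    rw [arcsinOp]
    simp only [Derivation.leibniz, Derivation.leibniz_pow, smul_eq_mul, nsmul_eq_mul, map_mul,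
      map_add, map_natCast, map_ofNat, map_one, Nat.add_sub_cancel, Derivation.map_natCast]
    push_cast
    linear_combination ((k : PowerSeries ℝ) + 2) * arcsinSq ^ (k + 1) * h
      + 4 * ((k : PowerSeries ℝ) + 2) * (k + 1) * arcsinSq ^ k * h1

end PowerSeries

/-! ### Central factorial numbers and Stirling numbers -/

namespace Polynomial

/-- `∏_{i < N} (X - i²)`, whose coefficients are the central factorial numbers of the first kind. -/
noncomputable def centralFactorial (N : ℕ) : Polynomial ℝ :=
  ∏ i ∈ Finset.range N, (X - C ((i : ℝ) ^ 2))

theorem centralFactorial_succ (N : ℕ) :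
    centralFactorial (N + 1) = centralFactorial N * (X - C ((N : ℝ) ^ 2)) :=
  Finset.prod_range_succ _ _

theorem coeff_centralFactorial_succ (N k : ℕ) : (centralFactorial (N + 1)).coeff (k + 1) =
    (centralFactorial N).coeff k - (N : ℝ) ^ 2 * (centralFactorial N).coeff (k + 1) := by
  rw [centralFactorial_succ, mul_sub, coeff_sub, coeff_mul_X, coeff_mul_C, mul_comm ((N : ℝ) ^ 2)]

theorem coeff_zero_centralFactorial_succ (N : ℕ) : (centralFactorial (N + 1)).coeff 0 = 0 := by
  simp [centralFactorial, Finset.prod_range_succ', coeff_zero_eq_eval_zero]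

end Polynomial

open PowerSeries in
-- Comparing coefficients in `arcsinOp_arcsinSq_pow` gives a recurrence in N which, after
-- normalisation, is that of the central factorial numbers.
theorem PowerSeries.coeff_arcsinSq_pow (N ℓ : ℕ) :
    ((2 * N).factorial : ℝ) * coeff N (arcsinSq ^ ℓ) * (-4) ^ ℓ =
      (-4) ^ N * (2 * ℓ).factorial * (Polynomial.centralFactorial N).coeff ℓ := by
  induction N generalizing ℓ with
  | zero =>
    cases ℓ with
    | zero => simp [Polynomial.centralFactorial]
    | succ ℓ => simp [Polynomial.centralFactorial, arcsinSq, arcsinSqCoeff, Polynomial.coeff_one]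
  | succ N ih =>
    cases ℓ with
    | zero => simp [Polynomial.coeff_zero_centralFactorial_succ, PowerSeries.coeff_one]
    | succ k =>
      have h := congrArg (coeff N) (arcsinOp_arcsinSq_pow k)
      rw [coeff_arcsinOp, coeff_C_mul] at h
      rw [Polynomial.coeff_centralFactorial_succ]
      have i1 := ih k
      have i2 := ih (k + 1)
      have f (n : ℕ) : ((2 * (n + 1)).factorial : ℝ) =
          (2 * n + 2) * (2 * n + 1) * (2 * n).factorial := by
        rw [show 2 * (n + 1) = 2 * n + 1 + 1 by ring, Nat.factorial_succ, Nat.factorial_succ]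
        push_cast; ring
      rw [f k] at i2 ⊢
      rw [f N]
      linear_combination ((2 * N).factorial : ℝ) * (-4) ^ (k + 1) * h + 4 * (N : ℝ) ^ 2 * i2
        - 4 * (2 * k + 2 : ℝ) * (2 * k + 1) * i1

namespace Polynomial

theorem coeff_descPochhammer (n k : ℕ) :
    (descPochhammer ℝ n).coeff k = (signedStirlingFirst n k : ℝ) := by
  induction n generalizing k with
  | zero =>
    cases k <;> simp [signedStirlingFirst, coeff_one]
  | succ n ih =>
    rw [descPochhammer_succ_right, mul_sub, coeff_sub, ← C_eq_natCast, coeff_mul_C]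
    cases k with
    | zero =>
      rw [coeff_mul_X_zero, ih]
      cases n <;> simp [signedStirlingFirst]
    | succ k =>
      rw [coeff_mul_X, ih, ih]
      simp only [signedStirlingFirst, Nat.stirlingFirst_succ_succ, Nat.add_sub_add_right]
      -- The exponent n - (k + 1) truncates for n ≤ k, where the unsigned number it multiplies is
      -- zero.
      rcases lt_trichotomy n k with h | h | h
      · simp [Nat.stirlingFirst_eq_zero_of_lt h, Nat.stirlingFirst_eq_zero_of_lt (h.trans k.lt_succ_self)]
      · subst h
        simp [Nat.stirlingFirst_eq_zero_of_lt n.lt_succ_self]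
      · obtain ⟨d, rfl⟩ := Nat.exists_eq_add_of_lt h
        rw [show k + d + 1 - k = d + 1 by omega, show k + d + 1 - (k + 1) = d by omega]
        push_cast
        ring

/-- The shift by N makes the roots -N, …, N symmetric, so they pair into factors X² - i²; the extra
X supplies the factor i = 0. -/
theorem X_mul_descPochhammer_comp (N : ℕ) :
    X * (descPochhammer ℝ (2 * N + 1)).comp (X + C (N : ℝ)) =
      (centralFactorial (N + 1)).comp (X ^ 2) := by
  induction N with
  | zero => simp [centralFactorial, sq, descPochhammer_one]
  | succ N ih =>
    rw [centralFactorial_succ, mul_comp, ← ih, show 2 * (N + 1) + 1 = 2 * N + 1 + 1 + 1 by ring,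
      descPochhammer_succ_left, descPochhammer_succ_right]
    simp only [mul_comp, comp_assoc, sub_comp, X_comp, C_comp, one_comp, natCast_comp]
    have : (X + C ((N + 1 : ℕ) : ℝ) - 1 : Polynomial ℝ) = X + C (N : ℝ) := by
      rw [Nat.cast_add, Nat.cast_one, C_add, C_1]; ring
    rw [this]
    simp only [map_pow, C_eq_natCast]
    push_cast
    ring

end Polynomial

open Polynomial in
-- With k = 2ℓ and m = 2n, the shift (k + m - 2)/2 is the midpoint ℓ + n - 1 of the roots, and Q is
-- the Taylor coefficient of order k - 1 there.
theorem stirlingQ_eq_coeff_centralFactorial (ℓ n : ℕ) (hℓ : 1 ≤ ℓ) :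
    stirlingQ (2 * ℓ) (2 * n) = (centralFactorial (ℓ + n)).coeff ℓ := by
  obtain ⟨k, rfl⟩ := Nat.exists_eq_add_of_le' hℓ
  have h := congrArg (fun p => p.coeff ((2 * k + 1) + 1)) (X_mul_descPochhammer_comp (k + n))
  simp only [coeff_X_mul] at h
  rw [show (2 * k + 1) + 1 = (k + 1) * 2 by ring, ← expand_eq_comp_X_pow,
    coeff_expand_mul (by norm_num)] at h
  have hd : (hasseDeriv (2 * k + 1) (descPochhammer ℝ (2 * (k + n) + 1))).natDegree < 2 * n + 1 := by
    have := natDegree_hasseDeriv_le (descPochhammer ℝ (2 * (k + n) + 1)) (2 * k + 1)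
    rw [descPochhammer_natDegree] at this
    omega
  rw [show k + 1 + n = k + n + 1 by ring, ← h, ← taylor_apply, taylor_coeff,
    eval_eq_sum_range' hd, stirlingQ]
  refine Finset.sum_congr rfl fun i _ => ?_
  rw [hasseDeriv_coeff, coeff_descPochhammer]
  rw [show 2 * (k + 1) + i - 1 = i + (2 * k + 1) by omega,
    show 2 * (k + 1) - 1 = 2 * k + 1 by omega,
    show 2 * (k + 1) + 2 * n - 1 = 2 * (k + n) + 1 by omega]
  congr 2
  push_cast
  ring

/-! ### The value of the arcsin² series at x = 1/2 -/

section TermwiseDifferentiation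

open Set

theorem summable_add_two_pow_mul_pow (k : ℕ) {r : ℝ} (h0 : 0 < r) (h1 : r < 1) :
    Summable fun n : ℕ => (n + 2 : ℝ) ^ k * r ^ n := by
  have h := summable_pow_mul_geometric_of_norm_lt_one (R := ℝ) k
    (r := r) (by rwa [Real.norm_of_nonneg h0.le])
  have h2 := ((summable_nat_add_iff 2).2 h).mul_right (r ^ 2)⁻¹
  refine h2.congr fun n => ?_
  push_cast
  field_simp
  ring

/-- Termwise differentiation of a power series whose coefficients grow at most polynomially. -/
theorem hasDerivAt_tsum_mul_pow {a : ℕ → ℝ} {k : ℕ} (ha : ∀ n : ℕ, |a n| ≤ (n + 1 : ℝ) ^ k)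
    {t : ℝ} (ht : |t| < 1) :
    HasDerivAt (fun x => ∑' n, a n * x ^ n) (∑' n : ℕ, (n + 1) * a (n + 1) * t ^ n) t := by
  obtain ⟨r, hr0, hr1⟩ := exists_between ht
  have hr : 0 < r := (abs_nonneg t).trans_lt hr0
  have hu : Summable fun n : ℕ => (n : ℝ) * (n + 1) ^ k * r ^ (n - 1) := by
    rw [← summable_nat_add_iff 1]
    refine (summable_add_two_pow_mul_pow (k + 1) hr hr1).of_nonneg_of_le
      (fun n => by positivity) fun n => ?_
    rw [Nat.add_sub_cancel, pow_succ', Nat.cast_add, Nat.cast_one, add_assoc, one_add_one_eq_two]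
    gcongr
    linarith
  have hb (n : ℕ) (y : ℝ) (hy : y ∈ Metric.ball (0 : ℝ) r) :
      ‖a n * (n * y ^ (n - 1))‖ ≤ (n : ℝ) * (n + 1) ^ k * r ^ (n - 1) := by
    rw [mem_ball_zero_iff, Real.norm_eq_abs] at hy
    rw [norm_mul, norm_mul, norm_pow, Real.norm_eq_abs, Real.norm_eq_abs, Real.norm_eq_abs,
      Nat.abs_cast, ← mul_assoc, mul_comm |a n|]
    have := ha n
    gcongr
  have htm : t ∈ Metric.ball (0 : ℝ) r := by rwa [mem_ball_zero_iff, Real.norm_eq_abs]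
  have key := hasDerivAt_tsum_of_isPreconnected (g := fun n y => a n * y ^ n)
    (g' := fun n y => a n * (n * y ^ (n - 1))) hu Metric.isOpen_ball
    (convex_ball (0 : ℝ) r).isPreconnected
    (fun n y _ => (hasDerivAt_pow n y).const_mul (a n)) hb (Metric.mem_ball_self hr)
    (summable_of_ne_finset_zero (s := {0}) fun n hn => by
      simp [zero_pow (show n ≠ 0 by simpa using hn)]) htm
  refine key.congr_deriv ?_
  rw [(Summable.of_norm_bounded hu fun n => hb n t htm).tsum_eq_zero_add]
  simp only [Nat.cast_zero, zero_mul, mul_zero, zero_add, Nat.add_sub_cancel]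
  refine tsum_congr fun n => ?_
  push_cast
  ring

theorem summable_mul_pow_of_abs_le {a : ℕ → ℝ} {k : ℕ} (ha : ∀ n : ℕ, |a n| ≤ (n + 2 : ℝ) ^ k)
    {t : ℝ} (ht : |t| < 1) : Summable fun n => a n * t ^ n := by
  obtain ⟨r, hr0, hr1⟩ := exists_between ht
  refine .of_norm_bounded
    (summable_add_two_pow_mul_pow k ((abs_nonneg t).trans_lt hr0) hr1) fun n => ?_
  rw [norm_mul, norm_pow, Real.norm_eq_abs, Real.norm_eq_abs]
  have := ha n
  gcongr

theorem abs_arcsinSqCoeff_le_one (n : ℕ) : |arcsinSqCoeff n| ≤ 1 := by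
  rw [abs_of_nonneg (arcsinSqCoeff_nonneg n)]
  exact arcsinSqCoeff_le_one n

theorem arcsinSqCoeff_ode {t : ℝ} (ht : |t| < 1) :
    4 * t * (1 - t) * ∑' n : ℕ, (n + 1) * (((n + 1 : ℕ) + 1) * arcsinSqCoeff (n + 1 + 1)) * t ^ n +
      (2 - 4 * t) * ∑' n : ℕ, (n + 1) * arcsinSqCoeff (n + 1) * t ^ n = 2 := by
  have hA : Summable fun n : ℕ => (n + 1) * arcsinSqCoeff (n + 1) * t ^ n := by
    refine summable_mul_pow_of_abs_le (k := 1) (fun n => ?_) ht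
    have := abs_arcsinSqCoeff_le_one (n + 1)
    rw [abs_mul, abs_of_nonneg (by positivity : (0 : ℝ) ≤ n + 1)]
    nlinarith [(n.cast_nonneg : (0 : ℝ) ≤ n)]
  have hB : Summable fun n : ℕ =>
      (n + 1) * (((n + 1 : ℕ) + 1) * arcsinSqCoeff (n + 1 + 1)) * t ^ n := by
    refine summable_mul_pow_of_abs_le (k := 2) (fun n => ?_) ht
    have := abs_arcsinSqCoeff_le_one (n + 1 + 1)
    have hn : (0 : ℝ) ≤ n := n.cast_nonneg
    rw [abs_mul, abs_mul, abs_of_nonneg (by positivity : (0 : ℝ) ≤ n + 1),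
      abs_of_nonneg (by positivity : (0 : ℝ) ≤ ((n + 1 : ℕ) : ℝ) + 1)]
    push_cast
    calc (n + 1 : ℝ) * ((n + 1 + 1) * |arcsinSqCoeff (n + 1 + 1)|)
        ≤ (n + 2) * ((n + 2) * 1) := by
          refine mul_le_mul (by linarith) (mul_le_mul (by linarith) this ?_ ?_) ?_ ?_ <;> positivity
      _ = _ := by ring
  have hA' := hA.hasSum
  have hB' := hB.hasSum
  set A := ∑' n : ℕ, (n + 1) * arcsinSqCoeff (n + 1) * t ^ n
  set B := ∑' n : ℕ, (n + 1) * (((n + 1 : ℕ) + 1) * arcsinSqCoeff (n + 1 + 1)) * t ^ n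
  have h1 : HasSum (fun m : ℕ => (m : ℝ) * arcsinSqCoeff m * t ^ m) (t * A) := by
    rw [← hasSum_nat_add_iff' 1, show t * A - _ = t * A by simp]
    refine (hA'.mul_left t).congr_fun fun n => ?_
    push_cast; ring
  have h2 : HasSum (fun m : ℕ => (m : ℝ) * (m + 1) * arcsinSqCoeff (m + 1) * t ^ m) (t * B) := by
    rw [← hasSum_nat_add_iff' 1, show t * B - _ = t * B by simp]
    refine (hB'.mul_left t).congr_fun fun n => ?_
    push_cast; ring
  have h3 : HasSum (fun m : ℕ => (m : ℝ) * (m - 1) * arcsinSqCoeff m * t ^ m) (t * t * B) := by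
    rw [← hasSum_nat_add_iff' 2, show t * t * B - _ = t * t * B by simp [Finset.sum_range_succ]]
    refine (hB'.mul_left (t * t)).congr_fun fun n => ?_
    push_cast; ring
  have h4 := (((h2.mul_left 4).sub (h3.mul_left 4)).add (hA'.mul_left 2)).sub (h1.mul_left 4)
  have h5 : HasSum (fun m : ℕ => if m = 0 then (2 : ℝ) else 0) 2 := hasSum_ite_eq 0 2
  have h6 := h4.unique (h5.congr_fun ?_)
  · linear_combination h6
  · intro m
    have h := arcsinSqCoeff_rec m
    rcases Nat.eq_zero_or_pos m with rfl | hm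
    · simp [arcsinSqCoeff]
    · rw [if_neg hm.ne'] at h ⊢
      linear_combination t ^ m * h

/-- With Y the sum of the series in t, substituting t = sin² θ turns the equation into (Y(sin² θ))''
= 2. The initial data vanish at θ = 0, so Y(sin² θ) = θ²; then θ = π/6. -/
theorem hasSum_arcsinSqCoeff :
    HasSum (fun n => arcsinSqCoeff n * (1 / 4) ^ n) ((Real.pi / 6) ^ 2) := by
  have hsum : Summable fun n => arcsinSqCoeff n * (1 / 4 : ℝ) ^ n :=
    summable_mul_pow_of_abs_le (k := 0) (fun n => by simpa using abs_arcsinSqCoeff_le_one n)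
      (by rw [abs_of_pos] <;> norm_num)
  set Y : ℝ → ℝ := fun x => ∑' n, arcsinSqCoeff n * x ^ n with hY
  set Y₁ : ℝ → ℝ := fun x => ∑' n : ℕ, (n + 1) * arcsinSqCoeff (n + 1) * x ^ n with hY₁
  have dY {t : ℝ} (ht : |t| < 1) : HasDerivAt Y (Y₁ t) t :=
    hasDerivAt_tsum_mul_pow (k := 0) (fun n => by simpa using abs_arcsinSqCoeff_le_one n) ht
  have dY₁ {t : ℝ} (ht : |t| < 1) := hasDerivAt_tsum_mul_pow (k := 1)
    (a := fun n : ℕ => (n + 1 : ℝ) * arcsinSqCoeff (n + 1)) (t := t) (fun n => by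
      rw [abs_mul, abs_of_nonneg (by positivity : (0 : ℝ) ≤ n + 1), pow_one]
      exact mul_le_of_le_one_right (by positivity) (abs_arcsinSqCoeff_le_one _)) ht
  have hs {θ : ℝ} (hθ : θ ∈ Icc 0 (Real.pi / 6)) : |Real.sin θ ^ 2| < 1 := by
    have hc : 0 < Real.cos θ := Real.cos_pos_of_mem_Ioo
      ⟨by linarith [hθ.1, Real.pi_pos], by linarith [hθ.2, Real.pi_pos]⟩
    rw [abs_of_nonneg (sq_nonneg _), Real.sin_sq]
    nlinarith
  have ds (θ : ℝ) : HasDerivAt (fun x => Real.sin x ^ 2) (2 * Real.sin θ * Real.cos θ) θ := by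
    exact ((Real.hasDerivAt_sin θ).fun_pow 2).congr_deriv (by simp)
  have d1 {θ : ℝ} (hθ : θ ∈ Icc 0 (Real.pi / 6)) :
      HasDerivAt (fun x => Y₁ (Real.sin x ^ 2) * (2 * Real.sin x * Real.cos x) - 2 * x) 0 θ := by
    have h := (((dY₁ (hs hθ)).comp θ (ds θ)).mul
      (((Real.hasDerivAt_sin θ).const_mul 2).mul (Real.hasDerivAt_cos θ))).sub
      ((hasDerivAt_id θ).const_mul 2)
    refine h.congr_deriv ?_
    have ho := arcsinSqCoeff_ode (hs hθ)
    have hc := Real.sin_sq_add_cos_sq θ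
    simp only [Function.comp_apply, Pi.mul_apply]
    generalize (∑' n : ℕ, (n + 1) * (((n + 1 : ℕ) + 1) * arcsinSqCoeff (n + 1 + 1)) *
      (Real.sin θ ^ 2) ^ n) = B at ho ⊢
    generalize (∑' n : ℕ, (n + 1) * arcsinSqCoeff (n + 1) * (Real.sin θ ^ 2) ^ n) = A at ho ⊢
    linear_combination ho + (4 * B * Real.sin θ ^ 2 + 2 * A) * hc
  have e1 {θ : ℝ} (hθ : θ ∈ Icc 0 (Real.pi / 6)) :
      Y₁ (Real.sin θ ^ 2) * (2 * Real.sin θ * Real.cos θ) - 2 * θ = 0 := by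
    have := constant_of_has_deriv_right_zero
      (fun x hx => (d1 hx).continuousAt.continuousWithinAt)
      (fun x hx => (d1 (Ico_subset_Icc_self hx)).hasDerivWithinAt) θ hθ
    simpa using this
  have d0 {θ : ℝ} (hθ : θ ∈ Icc 0 (Real.pi / 6)) :
      HasDerivAt (fun x => Y (Real.sin x ^ 2) - x ^ 2) 0 θ := by
    have h := ((dY (hs hθ)).comp θ (ds θ)).sub (hasDerivAt_pow 2 θ)
    refine h.congr_deriv ?_
    have := e1 hθ
    norm_num
    linear_combination this
  have e0 := constant_of_has_deriv_right_zero
      (fun x hx => (d0 hx).continuousAt.continuousWithinAt)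
      (fun x hx => (d0 (Ico_subset_Icc_self hx)).hasDerivWithinAt) (Real.pi / 6)
      (right_mem_Icc.2 (by positivity))
  have hY0 : Y 0 = 0 := by
    rw [hY]
    refine (tsum_congr fun n => ?_).trans tsum_zero
    cases n <;> simp [arcsinSqCoeff]
  rw [Real.sin_pi_div_six, Real.sin_zero, zero_pow two_ne_zero, hY0, sub_zero,
    sub_eq_zero] at e0
  rw [← e0, show (1 / 2 : ℝ) ^ 2 = 1 / 4 by norm_num]
  exact hsum.hasSum

end TermwiseDifferentiation

/-! ### The binomial series and its rearrangement -/

theorem choose_eq_fallingFactorial_div (α : ℝ) (j : ℕ) :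
    Ring.choose α j = fallingFactorial α j / (j.factorial : ℝ) := by
  rw [eq_div_iff (by positivity), ← nsmul_eq_mul', ← Ring.descPochhammer_eq_factorial_smul_choose,
    fallingFactorial]
  induction j with
  | zero => simp
  | succ j ih =>
    rw [Finset.prod_range_succ, ← ih, descPochhammer_succ_right]
    simp [Polynomial.smeval_mul, Polynomial.smeval_natCast]

theorem hasSum_choose_mul_pow (α : ℝ) {s : ℝ} (hs : |s| < 1) :
    HasSum (fun j => Ring.choose α j * s ^ j) ((1 + s) ^ α) := by
  have h := (Real.one_add_rpow_hasFPowerSeriesOnBall_zero (a := α)).hasSum (y := s)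
    (by simpa [enorm_eq_nnnorm, ← NNReal.coe_lt_coe] using hs)
  simpa [-FormalMultilinearSeries.apply_eq_prod_smul_coeff, mul_comm] using h

namespace PowerSeries

theorem hasSum_coeff_pow {g : PowerSeries ℝ} (hg : ∀ n, 0 ≤ coeff n g) {s : ℝ}
    (hs : HasSum (fun n => coeff n g) s) (j : ℕ) :
    (∀ n, 0 ≤ coeff n (g ^ j)) ∧ HasSum (fun n => coeff n (g ^ j)) (s ^ j) := by
  induction j with
  | zero =>
    refine ⟨fun n => ?_, ?_⟩
    · rw [pow_zero, coeff_one]; split_ifs <;> norm_num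
    · simpa [coeff_one] using hasSum_ite_eq (0 : ℕ) (1 : ℝ)
  | succ j ih =>
    obtain ⟨ih0, ih1⟩ := ih
    simp only [pow_succ, coeff_mul]
    refine ⟨fun n => Finset.sum_nonneg fun p _ => mul_nonneg (ih0 _) (hg _), ?_⟩
    have h1 := ih1.summable.norm
    have h2 := hs.summable.norm
    rw [← ih1.tsum_eq, ← hs.tsum_eq, tsum_mul_tsum_eq_tsum_sum_antidiagonal_of_summable_norm h1 h2]
    exact (summable_norm_sum_mul_antidiagonal_of_summable_norm h1 h2).of_norm.hasSum

theorem coeff_pow_eq_zero_of_lt {R : Type*} [CommRing R] {g : PowerSeries R}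
    (h0 : constantCoeff g = 0) {n j : ℕ} (h : n < j) : coeff n (g ^ j) = 0 :=
  X_pow_dvd_iff.1 (pow_dvd_pow_of_dvd (X_dvd_iff.2 h0) j) n h

/-- The binomial series composed with a power series with nonnegative coefficients, summed by
powers of the variable. -/
theorem hasSum_one_add_rpow {g : PowerSeries ℝ} (hg : ∀ n, 0 ≤ coeff n g)
    (h0 : constantCoeff g = 0) {s : ℝ} (hs : HasSum (fun n => coeff n g) s) (hs1 : s < 1) (α : ℝ) :
    HasSum (fun n => ∑ j ∈ Finset.range (n + 1), Ring.choose α j * coeff n (g ^ j))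
      ((1 + s) ^ α) := by
  have hs0 : 0 ≤ s := hs.nonneg hg
  have hc := hasSum_choose_mul_pow α (s := s) (by rwa [abs_of_nonneg hs0])
  have hp := hasSum_coeff_pow hg hs
  have hf (j : ℕ) : HasSum (fun n => Ring.choose α j * coeff n (g ^ j)) (Ring.choose α j * s ^ j) :=
    (hp j).2.mul_left _
  -- Nonnegative coefficients make the norms in row j sum to |C(α, j)| s^j, which is summable since
  -- 0 ≤ s < 1.
  have hS : Summable fun p : ℕ × ℕ => Ring.choose α p.1 * coeff p.2 (g ^ p.1) := by
    refine Summable.of_norm ?_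
    rw [summable_prod_of_nonneg fun _ => norm_nonneg _]
    refine ⟨fun j => (hf j).summable.norm, hc.summable.norm.congr fun j => ?_⟩
    simp only [norm_mul, tsum_mul_left, norm_pow, Real.norm_of_nonneg ((hp j).1 _), (hp j).2.tsum_eq,
      Real.norm_of_nonneg hs0]
  have hT := hS.hasSum
  rw [(hT.prod_fiberwise hf).unique hc] at hT
  refine ((Equiv.prodComm ℕ ℕ).hasSum_iff.2 hT).prod_fiberwise fun n => ?_
  refine hasSum_sum_of_ne_finset_zero fun j hj => ?_
  simp only [Function.comp_apply, Equiv.prodComm_apply, Prod.fst_swap, Prod.snd_swap]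
  rw [coeff_pow_eq_zero_of_lt h0 (by simpa using hj), mul_zero]

/-! ### Coefficients of the powers of (arcsin x / x)² - 1 -/

/-- `(arcsin x / x)² - 1` as a power series in `(2 x)²`. -/
noncomputable def arcsinDivSqSubOne : PowerSeries ℝ :=
  mk fun n => if n = 0 then 0 else arcsinSqCoeff (n + 1) * (1 / 4) ^ n

theorem coeff_one_add_arcsinDivSqSubOne (n : ℕ) :
    coeff n (1 + arcsinDivSqSubOne) = arcsinSqCoeff (n + 1) * (1 / 4) ^ n := by
  rw [map_add, coeff_one, arcsinDivSqSubOne, coeff_mk]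
  split_ifs with h
  · subst h; simp [arcsinSqCoeff]
  · simp

theorem hasSum_arcsinDivSqSubOne :
    HasSum (fun n => coeff n arcsinDivSqSubOne) (Real.pi ^ 2 / 9 - 1) := by
  have h1 : HasSum (fun n => coeff n (1 + arcsinDivSqSubOne)) (Real.pi ^ 2 / 9) := by
    simp only [coeff_one_add_arcsinDivSqSubOne]
    have h := ((hasSum_nat_add_iff' 1).2 hasSum_arcsinSqCoeff).mul_left 4
    have e : 4 * ((Real.pi / 6) ^ 2 - ∑ i ∈ Finset.range 1, arcsinSqCoeff i * (1 / 4) ^ i) =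
        Real.pi ^ 2 / 9 := by
      rw [Finset.sum_range_one, arcsinSqCoeff]; ring
    rw [e] at h
    exact h.congr_fun fun n => by ring
  have h2 : HasSum (fun n => coeff n (1 : PowerSeries ℝ)) 1 := by
    simpa [coeff_one] using hasSum_ite_eq (0 : ℕ) (1 : ℝ)
  exact (h1.sub h2).congr_fun fun n => by simp

/-- Dividing arcsin^(2ℓ) by x^(2ℓ) shifts the index by ℓ, and rescaling by 1/4 reduces (-4)^n to
(-1)^n. -/
theorem coeff_one_add_arcsinDivSqSubOne_pow (ℓ n : ℕ) (hℓ : 1 ≤ ℓ) :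
    coeff n ((1 + arcsinDivSqSubOne) ^ ℓ) =
      (-1) ^ n * ((2 * ℓ).factorial * (stirlingQ (2 * ℓ) (2 * n) /
        (2 * ℓ + 2 * n).factorial)) := by
  have e1 : 1 + arcsinDivSqSubOne = rescale (1 / 4) (mk fun n => arcsinSqCoeff (n + 1)) := by
    ext n
    rw [coeff_one_add_arcsinDivSqSubOne, coeff_rescale, coeff_mk, mul_comm]
  have e2 : arcsinSq = X * mk fun n => arcsinSqCoeff (n + 1) := by
    ext n
    cases n with
    | zero => simp [arcsinSq, arcsinSqCoeff]
    | succ n => rw [coeff_succ_X_mul, coeff_mk, arcsinSq, coeff_mk]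
  have h := coeff_arcsinSq_pow (n + ℓ) ℓ
  rw [e2, mul_pow, coeff_X_pow_mul, add_comm n ℓ, ← stirlingQ_eq_coeff_centralFactorial ℓ n hℓ,
    mul_add] at h
  rw [e1, ← map_pow, coeff_rescale, ← mul_div_assoc, ← mul_div_assoc, eq_div_iff (by positivity)]
  have h4 : ((-4 : ℝ)) ^ ℓ ≠ 0 := by positivity
  have h5 : (1 / 4 : ℝ) ^ n * (-4) ^ n = (-1) ^ n := by rw [← mul_pow]; norm_num
  apply mul_right_cancel₀ h4
  rw [← h5]
  rw [pow_add] at h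
  linear_combination (1 / 4 : ℝ) ^ n * h

theorem coeff_arcsinDivSqSubOne_pow (j n : ℕ) (hn : 1 ≤ n) :
    coeff n (arcsinDivSqSubOne ^ j) = (-1) ^ n * ((-1) ^ j * ∑ ℓ ∈ Finset.Icc 1 j,
      (-1 : ℝ) ^ ℓ * (2 * ℓ).factorial * j.choose ℓ *
        (stirlingQ (2 * ℓ) (2 * n) / (2 * ℓ + 2 * n).factorial)) := by
  have e : arcsinDivSqSubOne ^ j = ((1 + arcsinDivSqSubOne) + C (-1 : ℝ)) ^ j := by
    rw [map_neg, map_one]; ring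
  rw [e, add_pow, map_sum, Finset.range_eq_Ico, Finset.sum_eq_sum_Ico_succ_bot (by omega)]
  -- The ℓ = 0 term is constant, hence invisible in degree n ≥ 1.
  have z : coeff n ((1 + arcsinDivSqSubOne) ^ 0 * C (-1 : ℝ) ^ (j - 0) *
      ((j.choose 0 : ℕ) : PowerSeries ℝ)) = 0 := by
    rw [pow_zero, one_mul, Nat.choose_zero_right, Nat.cast_one, mul_one, ← map_pow, coeff_C,
      if_neg (by omega)]
  rw [z, zero_add, Finset.mul_sum, Finset.mul_sum]
  refine Finset.sum_congr (by ext; simp) fun ℓ hℓ => ?_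
  obtain ⟨h1, h2⟩ := Finset.mem_Ico.1 hℓ
  obtain ⟨d, rfl⟩ := Nat.exists_eq_add_of_le (Nat.lt_succ_iff.1 h2)
  rw [← map_natCast (C : ℝ →+* PowerSeries ℝ), ← map_pow, coeff_mul_C, coeff_mul_C,
    coeff_one_add_arcsinDivSqSubOne_pow _ _ (by omega), Nat.add_sub_cancel_left, pow_add]
  have : ((-1 : ℝ)) ^ ℓ * (-1) ^ ℓ = 1 := by rw [← mul_pow]; norm_num
  linear_combination (-(-1 : ℝ) ^ d * (-1) ^ n * (2 * ℓ).factorial * (ℓ + d).choose ℓ *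
    (stirlingQ (2 * ℓ) (2 * n) / (2 * ℓ + 2 * n).factorial)) * this

end PowerSeries

theorem corollary5p2 (α : ℝ) :
    HasSum
      (fun n : ℕ+ =>
        (-1 : ℝ) ^ (n : ℕ) *
          ∑ j ∈ Finset.Icc 1 (n : ℕ),
            (-1 : ℝ) ^ j * (fallingFactorial α j / (Nat.factorial j : ℝ)) *
              ∑ ℓ ∈ Finset.Icc 1 j,
                (-1 : ℝ) ^ ℓ * (Nat.factorial (2 * ℓ) : ℝ) * (Nat.choose j ℓ : ℝ) *
                  (stirlingQ (2 * ℓ) (2 * (n : ℕ)) /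
                    (Nat.factorial (2 * ℓ + 2 * (n : ℕ)) : ℝ)))
      ((Real.pi ^ 2 / 9) ^ α - 1) := by
  set g := PowerSeries.arcsinDivSqSubOne with hg
  have hnn (n : ℕ) : 0 ≤ PowerSeries.coeff n g := by
    rw [hg, PowerSeries.arcsinDivSqSubOne, PowerSeries.coeff_mk]
    split_ifs
    · rfl
    · exact mul_nonneg (arcsinSqCoeff_nonneg _) (by positivity)
  have h0 : PowerSeries.constantCoeff g = 0 := by
    simp [hg, PowerSeries.arcsinDivSqSubOne]
  -- The crude bound π < 4 suffices, as 16 < 18.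
  have hpi : Real.pi ^ 2 / 9 - 1 < 1 := by
    nlinarith [Real.pi_pos, Real.pi_lt_four]
  have h := PowerSeries.hasSum_one_add_rpow hnn h0 PowerSeries.hasSum_arcsinDivSqSubOne hpi α
  set f : ℕ → ℝ := fun n =>
    ∑ j ∈ Finset.range (n + 1), Ring.choose α j * PowerSeries.coeff n (g ^ j) with hf
  have hf0 : f 0 = 1 := by simp [hf]
  -- Removing the n = 0 term accounts for the -1. In ℝ, `HasSum` is unconditional, hence absolute,
  -- convergence.
  have h' : HasSum (fun n : ℕ+ => f n) ((Real.pi ^ 2 / 9) ^ α - 1) := by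
    rwa [hasSum_pnat_iff, hf0, sub_add_cancel, ← add_sub_cancel 1 (Real.pi ^ 2 / 9)]
  refine h'.congr_fun fun n => ?_
  simp only [hf]
  rw [Finset.range_eq_Ico, Finset.sum_eq_sum_Ico_succ_bot (by omega), pow_zero,
    PowerSeries.coeff_one, if_neg n.ne_zero, mul_zero, zero_add, Finset.mul_sum]
  refine Finset.sum_congr (by ext; simp) fun j _ => ?_
  rw [hg, PowerSeries.coeff_arcsinDivSqSubOne_pow j n n.pos, choose_eq_fallingFactorial_div]
  ring
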